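/- Let $G$ be a compact Hausdorff topological group (in particular, a finite group or a compact Lie group) with normalized Haar measure $dg$, and let $U$ be a continuous unitary representation of $G$ on a finite-dimensional complex Hilbert space $\mathcal H$. The representation can be decomposed into irreps: up to unitary equivalence $$\mathcal H=\bigoplus_\mu \mathcal M_\mu\otimes\mathcal N_\mu,\qquad U(g)=\bigoplus_\mu U^{(\mu)}(g)\otimes I_{\mathcal N_\mu},$$ where the $\mu$ label finitely many pairwise inequivalent irreducible unitary representations $U^{(\mu)}$ of $G$ on the spaces $\mathcal M_\mu$ of dimension $d_\mu$, and the multiplicity spaces $\mathcal N_\mu$ are nonzero. Fix any such decomposition and let $\Pi_\mu$ be the projection of $\mathcal H$ onto $\mathcal M_\mu\otimes\mathcal N_\mu$. For a unit vector $\psi\in\mathcal H$ let $$\chi_\psi(g)=\langle\psi|U(g)|\psi\rangle,\qquad F_\psi^{(\mu)}=\mathrm{tr}_{\mathcal N_\mu}\big(\Pi_\mu|\psi\rangle\langle\psi|\Pi_\mu\big),\qquad \chi^{(\mu)}_\psi(g)=\mathrm{tr}\big(U^{(\mu)}(g)F_\psi^{(\mu)}\big)$$ be its characteristic function, its reduction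 onto the irrep $\mu$, and the $\mu$ component of its characteristic function. Then for all unit vectors $\psi_1,\psi_2\in\mathcal H$ there exists a unitary $V$ on $\mathcal H$ that is $G$-invariant, i.e. $VU(g)=U(g)V$ for all $g\in G$, such that both $$|\langle\psi_2|V|\psi_1\rangle|\ \ge\ 1-\frac12\Big(\sum_\mu d_\mu^2\Big)\int dg\,\big|\chi_{\psi_1}(g)-\chi_{\psi_2}(g)\big|$$ and $$|\langle\psi_2|V|\psi_1\rangle|\ \ge\ 1-\frac12\sum_\mu d_\mu^2\int dg\,\big|\chi^{(\mu)}_{\psi_1}(g)-\chi^{(\mu)}_{\psi_2}(g)\big|,$$ where both sums run over the irreps $\mu$ in which $\psi_1$ or $\psi_2$ has a nonzero component, i.e. $\Pi_\mu\psi_1\ne0$ or $\Pi_\mu\psi_2\ne0$. -/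

import Mathlib

noncomputable section

/-- The matrix representation `π` of `G` on `ℂ^d`, as a `Representation`. -/
def matrixRep {G : Type*} [Group G] {d : ℕ} (π : G →* Matrix.unitaryGroup (Fin d) ℂ) :
    Representation ℂ G (Fin d → ℂ) where
  toFun g := Matrix.toLin' (π g : Matrix (Fin d) (Fin d) ℂ)
  map_one' := by simp [Module.End.one_eq_id]
  map_mul' g h := by simp [Matrix.toLin'_mul, Module.End.mul_eq_comp]

/-- The partial trace over the second tensor factor of an operator on `ℂ^m ⊗ ℂ^n`. -/
def partialTraceRight {m n : Type*} [Fintype n] (A : Matrix (m × n) (m × n) ℂ) :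
    Matrix m m ℂ :=
  Matrix.of fun i j => ∑ a, A (i, a) (j, a)

variable {G : Type*} [Group G] {H : Type*} [NormedAddCommGroup H] [InnerProductSpace ℂ H]

/-- A decomposition `H = ⨁_μ M_μ ⊗ N_μ`, `U(g) = ⨁_μ U_μ(g) ⊗ 1` of a unitary representation into
pairwise inequivalent irreps `U_μ`, where `M_μ = ℂ^(d_μ)` and `N_μ = ℂ^(n_μ)` are nonzero.
The identification of `H` with the direct sum is given by the orthonormal basis of `H` that
corresponds to the product bases `e_i ⊗ f_a` of the summands `M_μ ⊗ N_μ`. -/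
structure IrrepDecomposition (U : G →* (H ≃ₗᵢ[ℂ] H)) where
  /-- the number of inequivalent irreps that occur -/
  numIrreps : ℕ
  /-- the dimension `d_μ` of the irrep `μ` -/
  dim : Fin numIrreps → ℕ
  /-- the multiplicity `n_μ` of the irrep `μ` -/
  mult : Fin numIrreps → ℕ
  mult_pos : ∀ μ, 0 < mult μ
  /-- the unitary irrep `U_μ` -/
  irrep : ∀ μ, G →* Matrix.unitaryGroup (Fin (dim μ)) ℂ
  irreducible : ∀ μ, (matrixRep (irrep μ)).IsIrreducible
  inequivalent : ∀ μ ν, μ ≠ ν → IsEmpty ((matrixRep (irrep μ)).Equiv (matrixRep (irrep ν)))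
  /-- the vectors `e_i ⊗ f_a` of `M_μ ⊗ N_μ` -/
  basis : OrthonormalBasis (Σ μ, Fin (dim μ) × Fin (mult μ)) ℂ H
  /-- `U(g) (e_i ⊗ f_a) = (U_μ(g) e_i) ⊗ f_a` -/
  map_basis : ∀ g μ i a, U g (basis ⟨μ, (i, a)⟩) =
    ∑ j, (irrep μ g : Matrix (Fin (dim μ)) (Fin (dim μ)) ℂ) j i • basis ⟨μ, (j, a)⟩

namespace IrrepDecomposition

variable {U : G →* (H ≃ₗᵢ[ℂ] H)} (D : IrrepDecomposition U)

/-- The component `Π_μ ψ` of `ψ`, as a vector of `M_μ ⊗ N_μ`. -/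
def component (ψ : H) (μ : Fin D.numIrreps) : Fin (D.dim μ) × Fin (D.mult μ) → ℂ :=
  fun p => D.basis.repr ψ ⟨μ, p⟩

/-- The reduction onto irreps `F^(μ) = tr_{N_μ} (Π_μ |ψ⟩⟨ψ| Π_μ)` of `ψ`. -/
def reduction (ψ : H) (μ : Fin D.numIrreps) : Matrix (Fin (D.dim μ)) (Fin (D.dim μ)) ℂ :=
  partialTraceRight (Matrix.vecMulVec (D.component ψ μ) (star (D.component ψ μ)))

/-- The `μ` component `χ_ψ^(μ)(g) = tr (U_μ(g) F^(μ))` of the characteristic function of `ψ`. -/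
def charFunComponent (ψ : H) (μ : Fin D.numIrreps) (g : G) : ℂ :=
  ((D.irrep μ g : Matrix (Fin (D.dim μ)) (Fin (D.dim μ)) ℂ) * D.reduction ψ μ).trace

open Classical in
/-- The irreps in which `ψ₁` or `ψ₂` has a nonzero component. -/
def jointSupport (ψ₁ ψ₂ : H) : Finset (Fin D.numIrreps) :=
  Finset.univ.filter fun μ => D.component ψ₁ μ ≠ 0 ∨ D.component ψ₂ μ ≠ 0

end IrrepDecomposition

/-- The characteristic function `χ_ψ(g) = ⟨ψ|U(g)|ψ⟩`. -/
def stateCharFun (U : G →* (H ≃ₗᵢ[ℂ] H)) (ψ : H) (g : G) : ℂ :=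
  inner ℂ ψ (U g ψ)

/-- `V` is a `G`-invariant unitary. -/
def IsGInvariant (U : G →* (H ≃ₗᵢ[ℂ] H)) (V : H ≃ₗᵢ[ℂ] H) : Prop :=
  ∀ g, V * U g = U g * V

end

/-!
`V` acts on the multiplicity spaces only. Writing the components of `ψ₁`, `ψ₂` in `M_μ ⊗ N_μ` as
`d_μ × n_μ` matrices `A`, `B`, the reductions are `F₁ = A Aᴴ` and `F₂ = B Bᴴ`, and the polar
decomposition of `Bᴴ A` provides a unitary of `N_μ` for which the overlap is the trace norm of
`Bᴴ A`, hence at least `Re tr (Q P)` with `P = √F₁`, `Q = √F₂`. Expanding `tr (P - Q)²` gives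
`2 Re tr (Q P) = tr F₁ + tr F₂ - tr (P - Q)²`, and `‖P - Q‖² ≤ ‖P² - Q²‖` because the square root
is operator monotone, so each irrep loses at most `d_μ ‖F₁ - F₂‖ / 2`. Schur orthogonality recovers
the reductions from the characteristic function, `F^(μ) = d_μ ∫ χ(g) U_μ(g)ᴴ dg`, and in the same
way from its `μ` component alone, whence `‖F₁ - F₂‖ ≤ d_μ ∫ |χ₁ - χ₂|`.

A decomposition exists because minimal invariant subspaces can be split off orthogonally. Equivalent
ones are made to carry the same matrix representation with respect to orthonormal bases: the Gram
matrix of a basis which transforms by a unitary irrep commutes with that irrep, so it is scalar.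
-/

noncomputable section

open Matrix MeasureTheory
open scoped Matrix.Norms.L2Operator ComplexOrder MatrixOrder

section CStar

variable {A : Type*} [CStarAlgebra A] [PartialOrder A] [StarOrderedRing A]

theorem norm_le_of_neg_algebraMap_le_of_le_algebraMap {a : A} {r : ℝ} (hr : 0 ≤ r)
    (hl : -algebraMap ℝ A r ≤ a) (hu : a ≤ algebraMap ℝ A r) : ‖a‖ ≤ r := by
  rcases subsingleton_or_nontrivial A with hA | hA
  · rwa [Subsingleton.elim a 0, norm_zero]
  have ha : IsSelfAdjoint a := by
    simpa using (IsSelfAdjoint.all r).algebraMap A |>.sub (sub_nonneg.2 hu).isSelfAdjoint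
  rw [← map_neg] at hl
  rcases CStarAlgebra.norm_or_neg_norm_mem_spectrum ha with h | h
  · exact (le_algebraMap_iff_spectrum_le ha).1 hu _ h
  · exact neg_le_neg_iff.1 ((algebraMap_le_iff_le_spectrum ha).1 hl _ h)

theorem le_add_algebraMap_sqrt_norm_mul_self_sub_mul_self {a b : A} (ha : 0 ≤ a) (hb : 0 ≤ b) :
    a ≤ b + algebraMap ℝ A √‖a * a - b * b‖ := by
  set ε := ‖a * a - b * b‖
  have hsa : IsSelfAdjoint (a * a - b * b) :=
    .sub (ha.isSelfAdjoint.commute_iff ha.isSelfAdjoint |>.1 (.refl a))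
      (hb.isSelfAdjoint.commute_iff hb.isSelfAdjoint |>.1 (.refl b))
  have hε : 0 ≤ algebraMap ℝ A √ε := algebraMap_nonneg A (Real.sqrt_nonneg ε)
  have hle : a * a ≤ (b + algebraMap ℝ A √ε) * (b + algebraMap ℝ A √ε) :=
    calc a * a = b * b + (a * a - b * b) := by abel
      _ ≤ b * b + algebraMap ℝ A ε := by gcongr; exact hsa.le_algebraMap_norm_self
      _ ≤ b * b + algebraMap ℝ A ε + 2 • √ε • b :=
        le_add_of_nonneg_right (nsmul_nonneg (smul_nonneg (Real.sqrt_nonneg ε) hb) 2)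
      _ = (b + algebraMap ℝ A √ε) * (b + algebraMap ℝ A √ε) := by
        rw [add_mul, mul_add, mul_add, ← map_mul, Real.mul_self_sqrt (norm_nonneg _),
          ← Algebra.commutes, ← Algebra.smul_def]
        abel
  simpa only [CFC.sqrt_mul_self _ ha, CFC.sqrt_mul_self _ (add_nonneg hb hε)]
    using CFC.sqrt_le_sqrt _ _ hle

theorem norm_sub_sq_le_norm_mul_self_sub_mul_self {a b : A} (ha : 0 ≤ a) (hb : 0 ≤ b) :
    ‖a - b‖ ^ 2 ≤ ‖a * a - b * b‖ := by
  refine (Real.le_sqrt (norm_nonneg _) (norm_nonneg _)).1 <|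
    norm_le_of_neg_algebraMap_le_of_le_algebraMap (Real.sqrt_nonneg _) ?_ ?_
  · rw [neg_le_sub_iff_le_add, norm_sub_rev]
    exact le_add_algebraMap_sqrt_norm_mul_self_sub_mul_self hb ha
  · rw [sub_le_iff_le_add']
    exact le_add_algebraMap_sqrt_norm_mul_self_sub_mul_self ha hb

end CStar

section MatrixTrace

variable {m n : Type*} [Fintype m] [Fintype n] [DecidableEq n]

theorem norm_apply_le_l2_opNorm (A : Matrix m n ℂ) (i : m) (j : n) : ‖A i j‖ ≤ ‖A‖ := by
  have h := A.l2_opNorm_mulVec (EuclideanSpace.single j 1)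
  have h2 := PiLp.norm_apply_le (WithLp.toLp 2 (A *ᵥ (EuclideanSpace.single j (1 : ℂ)).ofLp)) i
  simpa using h2.trans h

variable [DecidableEq m]

theorem norm_trace_le_card_mul_l2_opNorm (A : Matrix m m ℂ) :
    ‖A.trace‖ ≤ Fintype.card m * ‖A‖ :=
  calc ‖A.trace‖ ≤ ∑ _ : m, ‖A‖ := norm_sum_le_of_le _ fun i _ => norm_apply_le_l2_opNorm A i i
    _ = Fintype.card m * ‖A‖ := by rw [Finset.sum_const, Finset.card_univ, nsmul_eq_mul]

theorem trace_mul_self_sub_le {P Q : Matrix m m ℂ} (hP : 0 ≤ P) (hQ : 0 ≤ Q) :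
    (P * P).trace.re + (Q * Q).trace.re - Fintype.card m * ‖P * P - Q * Q‖ ≤
      2 * (Q * P).trace.re := by
  have h : ((P - Q) * (P - Q)).trace.re ≤ Fintype.card m * ‖P * P - Q * Q‖ :=
    calc ((P - Q) * (P - Q)).trace.re ≤ Fintype.card m * ‖(P - Q) * (P - Q)‖ :=
          (Complex.re_le_norm _).trans (norm_trace_le_card_mul_l2_opNorm _)
      _ ≤ Fintype.card m * ‖P - Q‖ ^ 2 := by
          rw [sq]; gcongr; exact norm_mul_le _ _
      _ ≤ Fintype.card m * ‖P * P - Q * Q‖ := by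
          gcongr; exact norm_sub_sq_le_norm_mul_self_sub_mul_self hP hQ
  rw [sub_mul, mul_sub, mul_sub, trace_sub, trace_sub, trace_sub, trace_mul_comm P Q] at h
  simp only [Complex.sub_re] at h
  linarith

end MatrixTrace

theorem exists_linearIsometry_range_of_norm_eq {𝕜 V E F : Type*} [RCLike 𝕜] [AddCommGroup V]
    [Module 𝕜 V] [NormedAddCommGroup E] [NormedSpace 𝕜 E] [NormedAddCommGroup F]
    [NormedSpace 𝕜 F] {f : V →ₗ[𝕜] E} {g : V →ₗ[𝕜] F} (h : ∀ x, ‖f x‖ = ‖g x‖) :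
    ∃ L : LinearMap.range f →ₗᵢ[𝕜] F, ∀ x, L (f.rangeRestrict x) = g x := by
  obtain ⟨s, hs⟩ := f.rangeRestrict.exists_rightInverse_of_surjective f.range_rangeRestrict
  have hfs (y : LinearMap.range f) : f (s y) = y := congrArg Subtype.val (LinearMap.congr_fun hs y)
  refine ⟨⟨g ∘ₗ s, fun y => ?_⟩, fun x => ?_⟩
  · rw [LinearMap.comp_apply, ← h, hfs, Submodule.coe_norm]
  · refine sub_eq_zero.1 (norm_eq_zero.1 ?_)
    change ‖g (s (f.rangeRestrict x)) - g x‖ = 0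
    rw [← map_sub, ← h, map_sub, hfs, LinearMap.codRestrict_apply, sub_self, norm_zero]

section PolarDecomposition

variable {k l m n : Type*} [Fintype k] [Fintype l]

theorem norm_toEuclideanLin_eq_of_conjTranspose_mul_self_eq [Fintype n] [DecidableEq n]
    {M : Matrix k n ℂ} {R : Matrix l n ℂ} (h : Mᴴ * M = Rᴴ * R) (x : EuclideanSpace ℂ n) :
    ‖M.toEuclideanLin x‖ = ‖R.toEuclideanLin x‖ := by
  classical
  refine (sq_eq_sq₀ (norm_nonneg _) (norm_nonneg _)).1 ?_
  simp_rw [@norm_sq_eq_re_inner ℂ, ← LinearMap.adjoint_inner_left,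
    ← toEuclideanLin_conjTranspose_eq_adjoint, ← LinearMap.comp_apply, ← toLpLin_mul_same, h]

theorem exists_l2_opNorm_le_one_and_mul_eq [DecidableEq k] [Finite n] {M : Matrix k n ℂ}
    {R : Matrix l n ℂ} (h : Mᴴ * M = Rᴴ * R) : ∃ X : Matrix l k ℂ, ‖X‖ ≤ 1 ∧ X * M = R := by
  classical
  have := Fintype.ofFinite n
  obtain ⟨L, hL⟩ := exists_linearIsometry_range_of_norm_eq
    (norm_toEuclideanLin_eq_of_conjTranspose_mul_self_eq h)
  let T := L.toContinuousLinearMap ∘L (LinearMap.range M.toEuclideanLin).orthogonalProjectionOnto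
  refine ⟨toEuclideanLin.symm T, ?_, toEuclideanLin.injective ?_⟩
  · rw [l2_opNorm_def, LinearEquiv.trans_apply, LinearEquiv.apply_symm_apply]
    refine T.opNorm_le_bound zero_le_one fun y => ?_
    rw [one_mul]
    exact (L.norm_map _).trans_le (Submodule.norm_orthogonalProjectionOnto_apply_le _ y)
  · rw [toLpLin_mul_same, LinearEquiv.apply_symm_apply]
    ext1 x
    simpa [T, ← hL] using congrArg L (Submodule.orthogonalProjectionOnto_mem_subspace_eq_self
      (M.toEuclideanLin.rangeRestrict x))

variable [Fintype m] [Fintype n]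

theorem exists_l2_opNorm_le_one_and_mul_nonneg [DecidableEq m] (A : Matrix m n ℂ) :
    ∃ X : Matrix n m ℂ, ‖X‖ ≤ 1 ∧ 0 ≤ A * X ∧ A * X * (A * X) = A * Aᴴ := by
  classical
  have h : 0 ≤ A * Aᴴ := (posSemidef_self_mul_conjTranspose A).nonneg
  have hsqrt : (CFC.sqrt (A * Aᴴ))ᴴ = CFC.sqrt (A * Aᴴ) := (CFC.sqrt_nonneg _).isSelfAdjoint
  obtain ⟨X, hX, hXA⟩ := exists_l2_opNorm_le_one_and_mul_eq (M := Aᴴ) (R := CFC.sqrt (A * Aᴴ)) <| by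
    rw [conjTranspose_conjTranspose, hsqrt, CFC.sqrt_mul_sqrt_self _ h]
  have hAX : A * Xᴴ = CFC.sqrt (A * Aᴴ) := by
    rw [← hsqrt, ← hXA, conjTranspose_mul, conjTranspose_conjTranspose]
  refine ⟨Xᴴ, (l2_opNorm_conjTranspose X).trans_le hX, ?_, ?_⟩
  · exact hAX ▸ CFC.sqrt_nonneg _
  · rw [hAX, CFC.sqrt_mul_sqrt_self _ h]

variable [DecidableEq n]

theorem exists_mem_unitaryGroup_mul_eq {M R : Matrix n n ℂ} (h : Mᴴ * M = Rᴴ * R) :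
    ∃ W ∈ unitaryGroup n ℂ, W * M = R := by
  obtain ⟨L, hL⟩ := exists_linearIsometry_range_of_norm_eq
    (norm_toEuclideanLin_eq_of_conjTranspose_mul_self_eq h)
  let W := toEuclideanLin.symm L.extend.toLinearMap
  have hW : W.toEuclideanLin = L.extend.toLinearMap := toEuclideanLin.apply_symm_apply _
  refine ⟨W, mem_unitaryGroup_iff'.2 (toEuclideanLin.injective ?_), toEuclideanLin.injective ?_⟩
  · rw [star_eq_conjTranspose, toLpLin_mul_same, toEuclideanLin_conjTranspose_eq_adjoint, hW,
      toLpLin_one]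
    exact L.extend.adjoint_comp_self'
  · rw [toLpLin_mul_same, hW]
    ext1 x
    rw [← hL]
    exact L.extend_apply (M.toEuclideanLin.rangeRestrict x)

theorem re_trace_mul_le_re_trace {R Z : Matrix n n ℂ} (hR : 0 ≤ R) (hZ : ‖Z‖ ≤ 1) :
    (R * Z).trace.re ≤ R.trace.re := by
  obtain ⟨C, rfl⟩ := CStarAlgebra.nonneg_iff_eq_star_mul_self.1 hR
  have hZ₂ : Z + star Z ≤ algebraMap ℝ _ 2 :=
    (IsSelfAdjoint.add_star_self Z).le_algebraMap_norm_self.trans <| by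
      gcongr
      linarith [norm_add_le Z (star Z), norm_star Z]
  have h : 0 ≤ (C * (algebraMap ℝ _ 2 - (Z + star Z)) * star C).trace :=
    (nonneg_iff_posSemidef.1 (star_right_conjugate_nonneg (sub_nonneg.2 hZ₂) C)).trace_nonneg
  have hstar : (star C * C * star Z).trace.re = (star C * C * Z).trace.re := by
    rw [trace_mul_comm, ← Complex.conj_re, starRingEnd_apply, ← trace_conjTranspose,
      ← star_eq_conjTranspose, star_mul, star_mul, star_star, star_star]
  have htr : (C * (algebraMap ℝ _ 2 - (Z + star Z)) * star C).trace =
      2 * (star C * C).trace - (star C * C * Z).trace - (star C * C * star Z).trace := by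
    rw [mul_assoc, trace_mul_comm, mul_assoc, trace_mul_comm, mul_sub, mul_add,
      ← Algebra.commutes, ← Algebra.smul_def, trace_sub, trace_add, trace_smul]
    simp [sub_sub]
  have h' : 0 ≤ 2 * (star C * C).trace.re - (star C * C * Z).trace.re -
      (star C * C * Z).trace.re := by
    simpa [htr, hstar] using (Complex.le_def.1 h).1
  linarith

theorem exists_mem_unitaryGroup_mul_nonneg (M : Matrix n n ℂ) :
    ∃ W ∈ unitaryGroup n ℂ, 0 ≤ W * M := by
  have h : 0 ≤ Mᴴ * M := (posSemidef_conjTranspose_mul_self M).nonneg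
  obtain ⟨W, hW, hWM⟩ := exists_mem_unitaryGroup_mul_eq (M := M) (R := CFC.sqrt (Mᴴ * M)) <| by
    rw [← star_eq_conjTranspose (CFC.sqrt _), (CFC.sqrt_nonneg _).isSelfAdjoint,
      CFC.sqrt_mul_sqrt_self _ h]
  exact ⟨W, hW, hWM ▸ CFC.sqrt_nonneg _⟩

theorem exists_mem_unitaryGroup_le_re_trace [DecidableEq m] (A B : Matrix m n ℂ) :
    ∃ W ∈ unitaryGroup n ℂ,
      (A * Aᴴ).trace.re + (B * Bᴴ).trace.re - Fintype.card m * ‖A * Aᴴ - B * Bᴴ‖ ≤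
        2 * (W * (Bᴴ * A)).trace.re := by
  obtain ⟨X, hX, hP, hPP⟩ := exists_l2_opNorm_le_one_and_mul_nonneg A
  obtain ⟨Y, hY, hQ, hQQ⟩ := exists_l2_opNorm_le_one_and_mul_nonneg B
  obtain ⟨W, hW, hR⟩ := exists_mem_unitaryGroup_mul_nonneg (Bᴴ * A)
  have hZ : ‖X * Yᴴ * star W‖ ≤ 1 := by
    rw [CStarRing.norm_mul_mem_unitary _ (Unitary.star_mem hW)]
    calc ‖X * Yᴴ‖ ≤ ‖X‖ * ‖Yᴴ‖ := l2_opNorm_mul X Yᴴ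
      _ ≤ 1 := mul_le_one₀ hX (norm_nonneg _) ((l2_opNorm_conjTranspose Y).trans_le hY)
  have hQP : (B * Y * (A * X)).trace = (W * (Bᴴ * A) * (X * Yᴴ * star W)).trace :=
    calc (B * Y * (A * X)).trace = ((B * Y)ᴴ * (A * X)).trace := by
          rw [← star_eq_conjTranspose, hQ.isSelfAdjoint]
      _ = (star W * W * (Bᴴ * A * (X * Yᴴ))).trace := by
          rw [mem_unitaryGroup_iff'.1 hW, one_mul, conjTranspose_mul, Matrix.mul_assoc,
            trace_mul_comm]
          simp only [Matrix.mul_assoc]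
      _ = (W * (Bᴴ * A) * (X * Yᴴ * star W)).trace := by
          rw [mul_assoc (star W), trace_mul_comm (star W)]
          simp only [mul_assoc]
  refine ⟨W, hW, ?_⟩
  calc _ ≤ 2 * (B * Y * (A * X)).trace.re := by
        simpa only [hPP, hQQ] using trace_mul_self_sub_le hP hQ
    _ ≤ 2 * (W * (Bᴴ * A)).trace.re := by
        rw [hQP]
        linarith [re_trace_mul_le_re_trace hR hZ]

end PolarDecomposition

theorem integrable_of_forall_apply {α m n : Type*} [Fintype m] [Fintype n] [DecidableEq n]
    [MeasurableSpace α] {ν : Measure α} {A : α → Matrix m n ℂ}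
    (hA : ∀ i j, Integrable (fun x => A x i j) ν) : Integrable A ν := by
  classical
  have h : A = fun x => ∑ i, ∑ j, A x i j • single i j (1 : ℂ) := by
    ext1 x
    simpa only [smul_single, smul_eq_mul, mul_one] using matrix_eq_sum_single (A x)
  rw [h]
  exact integrable_finsetSum _ fun i _ => integrable_finsetSum _ fun j _ => (hA i j).smul_const _

theorem trace_mul_smul_conjTranspose_apply {m n : Type*} [Fintype m] [DecidableEq m] [Fintype n]
    [DecidableEq n] (S F : Matrix m m ℂ) (P : Matrix n n ℂ) (p q : n) :
    ((S * F).trace • Pᴴ) p q = ∑ b : m, (F * (S * single b p (1 : ℂ) * Pᴴ)) b q := by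
  have h (b : m) : (F * (S * single b p (1 : ℂ) * Pᴴ)) b q = (F * S) b b * Pᴴ p q := by
    rw [← Matrix.mul_assoc, ← Matrix.mul_assoc, Matrix.mul_apply,
      Finset.sum_eq_single_of_mem p (Finset.mem_univ p), mul_single_apply_same, mul_one]
    intro k _ hk
    rw [mul_single_apply_of_ne _ _ _ _ _ hk, zero_mul]
  rw [Matrix.smul_apply, trace_mul_comm, trace, Finset.sum_smul]
  exact Finset.sum_congr rfl fun b _ => (h b).symm

section Schur

variable {G : Type*} [Group G] {d e : ℕ} {π : G →* unitaryGroup (Fin d) ℂ}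
  {σ : G →* unitaryGroup (Fin e) ℂ}

/-- A matrix intertwining two matrix representations, as an intertwining map. -/
def intertwiningMapOfMatrix (X : Matrix (Fin e) (Fin d) ℂ)
    (hX : ∀ g, X * (π g).1 = (σ g).1 * X) : (matrixRep π).IntertwiningMap (matrixRep σ) where
  toLinearMap := toLin' X
  isIntertwining' g := by
    change toLin' X ∘ₗ toLin' _ = toLin' _ ∘ₗ toLin' X
    rw [← toLin'_mul, ← toLin'_mul, hX]

theorem eq_zero_of_intertwines (hπ : (matrixRep π).IsIrreducible)
    (hσ : (matrixRep σ).IsIrreducible) (hne : IsEmpty ((matrixRep π).Equiv (matrixRep σ)))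
    {X : Matrix (Fin e) (Fin d) ℂ} (hX : ∀ g, X * (π g).1 = (σ g).1 * X) : X = 0 := by
  have h : intertwiningMapOfMatrix X hX = 0 := Subsingleton.elim _ _
  exact toLin'.map_eq_zero_iff.1 (congrArg (fun f => f.toLinearMap) h)

theorem exists_eq_smul_one_of_commutes (hπ : (matrixRep π).IsIrreducible)
    {X : Matrix (Fin d) (Fin d) ℂ} (hX : ∀ g, X * (π g).1 = (π g).1 * X) :
    ∃ c : ℂ, X = c • 1 := by
  obtain ⟨c, hc⟩ :=
    (Representation.IsIrreducible.algebraMap_intertwiningMap_bijective_of_isAlgClosed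
      (ρ := matrixRep π)).2 (intertwiningMapOfMatrix X hX)
  refine ⟨c, toLin'.injective ?_⟩
  rw [map_smul, toLin'_one]
  exact (congrArg (fun f => f.toLinearMap) hc).symm

theorem dim_pos_of_isIrreducible (hπ : (matrixRep π).IsIrreducible) : 0 < d := by
  by_contra! h
  obtain rfl := Nat.le_zero.1 h
  obtain ⟨S, T, hST⟩ := hπ.toNontrivial
  exact hST (Subrepresentation.toSubmodule_injective (Subsingleton.elim _ _))

variable [MeasurableSpace G] {ν : Measure G}

theorem integrable_mul_mul_conjTranspose [IsFiniteMeasure ν]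
    (hπ : ∀ i j, AEStronglyMeasurable (fun g => (π g).1 i j) ν)
    (hσ : ∀ i j, AEStronglyMeasurable (fun g => (σ g).1 i j) ν) (X : Matrix (Fin e) (Fin d) ℂ) :
    Integrable (fun g => (σ g).1 * X * (π g).1ᴴ) ν := by
  refine integrable_of_forall_apply fun i j => ?_
  simp only [mul_apply, conjTranspose_apply]
  refine integrable_finsetSum _ fun b _ => .mul_bdd (c := 1) (integrable_finsetSum _ fun a _ =>
    .mul_const (.of_bound (hσ i a) 1 (.of_forall fun g => ?_)) _) (hπ j b).star
    (.of_forall fun g => ?_)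
  · exact entry_norm_bound_of_unitary (σ g).2 i a
  · rw [norm_star]
    exact entry_norm_bound_of_unitary (π g).2 j b

theorem integrable_trace_mul_smul_conjTranspose [IsFiniteMeasure ν]
    (hπ : ∀ i j, AEStronglyMeasurable (fun g => (π g).1 i j) ν)
    (hσ : ∀ i j, AEStronglyMeasurable (fun g => (σ g).1 i j) ν) (F : Matrix (Fin e) (Fin e) ℂ) :
    Integrable (fun g => ((σ g).1 * F).trace • (π g).1ᴴ) ν := by
  refine integrable_of_forall_apply fun p q => ?_
  simp only [trace_mul_smul_conjTranspose_apply]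
  exact integrable_finsetSum _ fun b _ => (LinearMap.toContinuousLinearMap
    (entryLinearMap ℂ ℂ b q ∘ₗ mulLeftLinearMap (Fin d) ℂ F)).integrable_comp
    (integrable_mul_mul_conjTranspose hπ hσ (single b p (1 : ℂ)))

theorem integral_trace_mul_smul_conjTranspose_apply [IsFiniteMeasure ν]
    (hπ : ∀ i j, AEStronglyMeasurable (fun g => (π g).1 i j) ν)
    (hσ : ∀ i j, AEStronglyMeasurable (fun g => (σ g).1 i j) ν)
    (F : Matrix (Fin e) (Fin e) ℂ) (p q : Fin d) :
    (∫ g, ((σ g).1 * F).trace • (π g).1ᴴ ∂ν) p q =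
      ∑ b : Fin e, (F * ∫ g, (σ g).1 * single b p (1 : ℂ) * (π g).1ᴴ ∂ν) b q := by
  let E := (entryLinearMap ℂ ℂ p q).toContinuousLinearMap
  let L (b : Fin e) :=
    (entryLinearMap ℂ ℂ b q ∘ₗ mulLeftLinearMap (Fin d) ℂ F).toContinuousLinearMap
  have hX (b : Fin e) := integrable_mul_mul_conjTranspose hπ hσ (single b p (1 : ℂ))
  calc (∫ g, ((σ g).1 * F).trace • (π g).1ᴴ ∂ν) p q
      = ∫ g, (((σ g).1 * F).trace • (π g).1ᴴ) p q ∂ν :=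
        (E.integral_comp_comm (integrable_trace_mul_smul_conjTranspose hπ hσ F)).symm
    _ = ∫ g, ∑ b : Fin e, L b ((σ g).1 * single b p (1 : ℂ) * (π g).1ᴴ) ∂ν :=
        integral_congr_ae (.of_forall fun g => trace_mul_smul_conjTranspose_apply _ F _ p q)
    _ = ∑ b : Fin e, ∫ g, L b ((σ g).1 * single b p (1 : ℂ) * (π g).1ᴴ) ∂ν :=
        integral_finsetSum _ fun b _ => (L b).integrable_comp (hX b)
    _ = ∑ b : Fin e, L b (∫ g, (σ g).1 * single b p (1 : ℂ) * (π g).1ᴴ ∂ν) :=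
        Finset.sum_congr rfl fun b _ => (L b).integral_comp_comm (hX b)

variable [MeasurableMul G] [ν.IsMulLeftInvariant]

theorem integral_mul_mul_conjTranspose_intertwines {X : Matrix (Fin e) (Fin d) ℂ}
    (hX : Integrable (fun g => (σ g).1 * X * (π g).1ᴴ) ν) (h : G) :
    (∫ g, (σ g).1 * X * (π g).1ᴴ ∂ν) * (π h).1 = (σ h).1 * ∫ g, (σ g).1 * X * (π g).1ᴴ ∂ν := by
  let L := (mulLeftLinearMap (Fin d) ℂ (σ h).1).toContinuousLinearMap
  let R := (mulRightLinearMap (Fin e) ℂ (π h).1).toContinuousLinearMap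
  have hpt (g : G) : (σ (h * g)).1 * X * (π (h * g)).1ᴴ * (π h).1 =
      (σ h).1 * ((σ g).1 * X * (π g).1ᴴ) := by
    have hh : (π h).1ᴴ * (π h).1 = 1 := mem_unitaryGroup_iff'.1 (π h).2
    simp only [map_mul, UnitaryGroup.mul_val, conjTranspose_mul, Matrix.mul_assoc, hh,
      Matrix.mul_one]
  calc (∫ g, (σ g).1 * X * (π g).1ᴴ ∂ν) * (π h).1
      = (∫ g, (σ (h * g)).1 * X * (π (h * g)).1ᴴ ∂ν) * (π h).1 := by
        rw [integral_mul_left_eq_self (fun g => (σ g).1 * X * (π g).1ᴴ) h]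
    _ = ∫ g, (σ (h * g)).1 * X * (π (h * g)).1ᴴ * (π h).1 ∂ν :=
        (R.integral_comp_comm (hX.comp_mul_left h)).symm
    _ = ∫ g, (σ h).1 * ((σ g).1 * X * (π g).1ᴴ) ∂ν := by simp_rw [hpt]
    _ = (σ h).1 * ∫ g, (σ g).1 * X * (π g).1ᴴ ∂ν := L.integral_comp_comm hX

theorem integral_mul_mul_conjTranspose_eq_zero [IsFiniteMeasure ν]
    (hπ : (matrixRep π).IsIrreducible) (hσ : (matrixRep σ).IsIrreducible)
    (hne : IsEmpty ((matrixRep π).Equiv (matrixRep σ)))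
    (hπm : ∀ i j, AEStronglyMeasurable (fun g => (π g).1 i j) ν)
    (hσm : ∀ i j, AEStronglyMeasurable (fun g => (σ g).1 i j) ν) (X : Matrix (Fin e) (Fin d) ℂ) :
    ∫ g, (σ g).1 * X * (π g).1ᴴ ∂ν = 0 :=
  eq_zero_of_intertwines hπ hσ hne fun h => integral_mul_mul_conjTranspose_intertwines
    (integrable_mul_mul_conjTranspose hπm hσm X) h

theorem dim_smul_integral_mul_mul_conjTranspose [IsProbabilityMeasure ν]
    (hπ : (matrixRep π).IsIrreducible)
    (hπm : ∀ i j, AEStronglyMeasurable (fun g => (π g).1 i j) ν) (X : Matrix (Fin d) (Fin d) ℂ) :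
    (d : ℂ) • ∫ g, (π g).1 * X * (π g).1ᴴ ∂ν = X.trace • (1 : Matrix (Fin d) (Fin d) ℂ) := by
  have hX := integrable_mul_mul_conjTranspose hπm hπm X
  obtain ⟨c, hc⟩ := exists_eq_smul_one_of_commutes hπ <|
    integral_mul_mul_conjTranspose_intertwines hX
  let T := (traceLinearMap (Fin d) ℂ ℂ).toContinuousLinearMap
  have htr (g : G) : ((π g).1 * X * (π g).1ᴴ).trace = X.trace := by
    have hg : (π g).1ᴴ * (π g).1 = 1 := mem_unitaryGroup_iff'.1 (π g).2
    rw [trace_mul_comm, ← Matrix.mul_assoc, hg, Matrix.one_mul]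
  have hcd : c * d = X.trace :=
    calc c * d = (c • (1 : Matrix (Fin d) (Fin d) ℂ)).trace := by
          rw [trace_smul, trace_one, Fintype.card_fin, smul_eq_mul]
      _ = (∫ g, (π g).1 * X * (π g).1ᴴ ∂ν).trace := by rw [hc]
      _ = ∫ g, ((π g).1 * X * (π g).1ᴴ).trace ∂ν := (T.integral_comp_comm hX).symm
      _ = X.trace := by simp only [htr, integral_const, probReal_univ, one_smul]
  rw [hc, smul_smul, mul_comm, hcd]

theorem integral_trace_mul_smul_conjTranspose_eq_zero [IsFiniteMeasure ν]
    (hπ : (matrixRep π).IsIrreducible) (hσ : (matrixRep σ).IsIrreducible)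
    (hne : IsEmpty ((matrixRep π).Equiv (matrixRep σ)))
    (hπm : ∀ i j, AEStronglyMeasurable (fun g => (π g).1 i j) ν)
    (hσm : ∀ i j, AEStronglyMeasurable (fun g => (σ g).1 i j) ν) (F : Matrix (Fin e) (Fin e) ℂ) :
    ∫ g, ((σ g).1 * F).trace • (π g).1ᴴ ∂ν = 0 := by
  ext p q
  simp only [integral_trace_mul_smul_conjTranspose_apply hπm hσm,
    integral_mul_mul_conjTranspose_eq_zero hπ hσ hne hπm hσm, Matrix.mul_zero, Matrix.zero_apply,
    Finset.sum_const_zero]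

theorem dim_smul_integral_trace_mul_smul_conjTranspose [IsProbabilityMeasure ν]
    (hπ : (matrixRep π).IsIrreducible)
    (hπm : ∀ i j, AEStronglyMeasurable (fun g => (π g).1 i j) ν) (F : Matrix (Fin d) (Fin d) ℂ) :
    (d : ℂ) • ∫ g, ((π g).1 * F).trace • (π g).1ᴴ ∂ν = F := by
  ext p q
  rw [Matrix.smul_apply, integral_trace_mul_smul_conjTranspose_apply hπm hπm, Finset.smul_sum]
  simp only [← Matrix.smul_apply, ← Matrix.mul_smul,
    dim_smul_integral_mul_mul_conjTranspose hπ hπm]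
  rw [Finset.sum_eq_single_of_mem p (Finset.mem_univ p), trace_single_eq_same, one_smul,
    Matrix.mul_one]
  intro b _ hb
  rw [trace_single_eq_of_ne b p 1 hb, zero_smul, Matrix.mul_zero, Matrix.zero_apply]

end Schur

namespace IrrepDecomposition

variable {G : Type*} [Group G] {H : Type*} [NormedAddCommGroup H] [InnerProductSpace ℂ H]
  {U : G →* (H ≃ₗᵢ[ℂ] H)} (D : IrrepDecomposition U)

/-- The components `Π_μ ψ` of a vector, as `d_μ × n_μ` matrices: `ℂ^d ⊗ ℂ^n` is identified with
the `d × n` matrices, so that `A ⊗ B` acts by `X ↦ A X Bᵀ`. -/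
def coeffMatrix : H ≃ₗ[ℂ] ∀ μ, Matrix (Fin (D.dim μ)) (Fin (D.mult μ)) ℂ where
  toFun ψ μ := of fun i a => D.basis.repr ψ ⟨μ, i, a⟩
  map_add' φ ψ := by ext; simp
  map_smul' c ψ := by ext; simp
  invFun A := D.basis.repr.symm (WithLp.toLp 2 fun p => A p.1 p.2.1 p.2.2)
  left_inv ψ := D.basis.repr.symm_apply_apply ψ
  right_inv A := by ext; simp

theorem coeffMatrix_apply (ψ : H) (μ : Fin D.numIrreps) (i : Fin (D.dim μ))
    (a : Fin (D.mult μ)) : D.coeffMatrix ψ μ i a = D.basis.repr ψ ⟨μ, i, a⟩ := rfl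

theorem coeffMatrix_basis (μ : Fin D.numIrreps) (i : Fin (D.dim μ)) (a : Fin (D.mult μ)) :
    D.coeffMatrix (D.basis ⟨μ, i, a⟩) = Pi.single μ (single i a 1) := by
  ext κ j b
  rw [coeffMatrix_apply, OrthonormalBasis.repr_self, PiLp.single_apply]
  obtain rfl | hκ := eq_or_ne κ μ
  · simp [single_apply, eq_comm]
  · rw [Pi.single_eq_of_ne hκ, Matrix.zero_apply, if_neg fun h => hκ (congrArg Sigma.fst h)]

theorem coeffMatrix_map (g : G) (ψ : H) (μ : Fin D.numIrreps) :
    D.coeffMatrix (U g ψ) μ = (D.irrep μ g).1 * D.coeffMatrix ψ μ := by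
  let L : H →ₗ[ℂ] ∀ ν, Matrix (Fin (D.dim ν)) (Fin (D.mult ν)) ℂ :=
    LinearMap.pi fun ν =>
      mulLeftLinearMap _ ℂ (D.irrep ν g).1 ∘ₗ LinearMap.proj ν ∘ₗ D.coeffMatrix.toLinearMap
  suffices h : D.coeffMatrix.toLinearMap ∘ₗ (U g).toLinearEquiv.toLinearMap = L from
    congrFun (LinearMap.congr_fun h ψ) μ
  refine D.basis.toBasis.ext fun ⟨κ, i, a⟩ => funext fun ν => ?_
  change D.coeffMatrix (U g (D.basis.toBasis _)) ν =
    (D.irrep ν g).1 * D.coeffMatrix (D.basis.toBasis _) ν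
  rw [OrthonormalBasis.coe_toBasis, D.map_basis, map_sum, Finset.sum_apply]
  simp only [map_smul, coeffMatrix_basis, Pi.smul_apply]
  obtain rfl | hν := eq_or_ne ν κ
  · ext j b
    simp [Matrix.sum_apply, single_apply, Matrix.mul_apply, ite_and]
  · simp only [Pi.single_eq_of_ne hν, smul_zero, Finset.sum_const_zero, Matrix.mul_zero]

theorem irrep_apply (g : G) (μ : Fin D.numIrreps) (i j : Fin (D.dim μ)) (a : Fin (D.mult μ)) :
    (D.irrep μ g).1 i j = inner ℂ (D.basis ⟨μ, i, a⟩) (U g (D.basis ⟨μ, j, a⟩)) := by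
  rw [← D.basis.repr_apply_apply]
  change _ = D.coeffMatrix _ μ i a
  rw [coeffMatrix_map, coeffMatrix_basis, Pi.single_eq_same, mul_single_apply_same, mul_one]

theorem aestronglyMeasurable_irrep_apply [MeasurableSpace G] {ν : Measure G}
    (hU : ∀ v, AEStronglyMeasurable (fun g => U g v) ν) (μ : Fin D.numIrreps)
    (i j : Fin (D.dim μ)) : AEStronglyMeasurable (fun g => (D.irrep μ g).1 i j) ν := by
  simp_rw [D.irrep_apply _ μ i j ⟨0, D.mult_pos μ⟩]
  exact aestronglyMeasurable_const.inner (hU _)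

theorem reduction_eq_mul_conjTranspose (ψ : H) (μ : Fin D.numIrreps) :
    D.reduction ψ μ = D.coeffMatrix ψ μ * (D.coeffMatrix ψ μ)ᴴ := by
  ext i j
  simp only [reduction, partialTraceRight, component, of_apply, vecMulVec_apply, Pi.star_apply,
    Matrix.mul_apply, conjTranspose_apply, coeffMatrix_apply]

theorem reduction_eq_of_notMem_jointSupport {ψ₁ ψ₂ : H} {μ : Fin D.numIrreps}
    (hμ : μ ∉ D.jointSupport ψ₁ ψ₂) : D.reduction ψ₁ μ = D.reduction ψ₂ μ := by
  simp only [jointSupport, Finset.mem_filter, Finset.mem_univ, true_and, not_or, not_not] at hμ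
  rw [reduction, reduction, hμ.1, hμ.2]

theorem inner_eq_sum_trace (φ ψ : H) :
    inner ℂ φ ψ = ∑ μ, ((D.coeffMatrix φ μ)ᴴ * D.coeffMatrix ψ μ).trace := by
  rw [← D.basis.repr.inner_map_map, PiLp.inner_apply, Fintype.sum_sigma]
  refine Finset.sum_congr rfl fun μ _ => ?_
  rw [Fintype.sum_prod_type_right]
  refine Finset.sum_congr rfl fun a _ => ?_
  rw [diag_apply, Matrix.mul_apply]
  exact Finset.sum_congr rfl fun i _ => mul_comm _ _

theorem sum_re_trace_reduction (ψ : H) :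
    ∑ μ, (D.reduction ψ μ).trace.re = ‖ψ‖ ^ 2 := by
  simp_rw [norm_sq_eq_re_inner (𝕜 := ℂ), D.inner_eq_sum_trace, reduction_eq_mul_conjTranspose,
    trace_mul_comm (D.coeffMatrix ψ _), map_sum, RCLike.re_eq_complex_re]

theorem stateCharFun_eq_sum (ψ : H) (g : G) :
    stateCharFun U ψ g = ∑ μ, D.charFunComponent ψ μ g := by
  rw [stateCharFun, D.inner_eq_sum_trace]
  refine Finset.sum_congr rfl fun μ _ => ?_
  rw [coeffMatrix_map, charFunComponent, reduction_eq_mul_conjTranspose, trace_mul_comm,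
    Matrix.mul_assoc]

theorem charFunComponent_sub (ψ₁ ψ₂ : H) (μ : Fin D.numIrreps) (g : G) :
    D.charFunComponent ψ₁ μ g - D.charFunComponent ψ₂ μ g =
      ((D.irrep μ g).1 * (D.reduction ψ₁ μ - D.reduction ψ₂ μ)).trace := by
  rw [charFunComponent, charFunComponent, Matrix.mul_sub, trace_sub]

theorem exists_isGInvariant_coeffMatrix_eq_mul
    {W : ∀ μ, Matrix (Fin (D.mult μ)) (Fin (D.mult μ)) ℂ}
    (hW : ∀ μ, W μ ∈ unitaryGroup (Fin (D.mult μ)) ℂ) :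
    ∃ V : H ≃ₗᵢ[ℂ] H, IsGInvariant U V ∧
      ∀ ψ μ, D.coeffMatrix (V ψ) μ = D.coeffMatrix ψ μ * W μ := by
  let T : H →ₗ[ℂ] H := D.coeffMatrix.symm.toLinearMap ∘ₗ LinearMap.pi fun μ =>
    mulRightLinearMap _ ℂ (W μ) ∘ₗ LinearMap.proj μ ∘ₗ D.coeffMatrix.toLinearMap
  have hT (ψ : H) (μ : Fin D.numIrreps) : D.coeffMatrix (T ψ) μ = D.coeffMatrix ψ μ * W μ :=
    congrFun (D.coeffMatrix.apply_symm_apply _) μ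
  have hinner (φ ψ : H) : inner ℂ (T φ) (T ψ) = inner ℂ φ ψ := by
    rw [D.inner_eq_sum_trace, D.inner_eq_sum_trace]
    refine Finset.sum_congr rfl fun μ _ => ?_
    have hWW : W μ * (W μ)ᴴ = 1 := mem_unitaryGroup_iff.1 (hW μ)
    rw [hT, hT, conjTranspose_mul, ← Matrix.mul_assoc, trace_mul_comm, ← Matrix.mul_assoc,
      ← Matrix.mul_assoc, hWW, Matrix.one_mul]
  have : FiniteDimensional ℂ H := D.basis.toBasis.finiteDimensional_of_finite
  refine ⟨(T.isometryOfInner hinner).toLinearIsometryEquiv rfl, fun g => ?_, hT⟩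
  ext ψ
  refine D.coeffMatrix.injective (funext fun μ => ?_)
  change D.coeffMatrix (T (U g ψ)) μ = D.coeffMatrix (U g (T ψ)) μ
  rw [hT, coeffMatrix_map, coeffMatrix_map, hT, Matrix.mul_assoc]

theorem exists_isGInvariant_le_norm_inner (ψ₁ ψ₂ : H) :
    ∃ V : H ≃ₗᵢ[ℂ] H, IsGInvariant U V ∧
      (‖ψ₁‖ ^ 2 + ‖ψ₂‖ ^ 2) / 2 - 1 / 2 * ∑ μ ∈ D.jointSupport ψ₁ ψ₂,
        D.dim μ * ‖D.reduction ψ₁ μ - D.reduction ψ₂ μ‖ ≤ ‖inner ℂ ψ₂ (V ψ₁)‖ := by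
  choose W hW hle using fun μ =>
    exists_mem_unitaryGroup_le_re_trace (D.coeffMatrix ψ₁ μ) (D.coeffMatrix ψ₂ μ)
  simp only [← reduction_eq_mul_conjTranspose, Fintype.card_fin] at hle
  obtain ⟨V, hV, hVψ⟩ := D.exists_isGInvariant_coeffMatrix_eq_mul hW
  have hinner : (inner ℂ ψ₂ (V ψ₁)).re =
      ∑ μ, (W μ * ((D.coeffMatrix ψ₂ μ)ᴴ * D.coeffMatrix ψ₁ μ)).trace.re := by
    simp only [D.inner_eq_sum_trace, Complex.re_sum, hVψ, ← Matrix.mul_assoc,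
      trace_mul_comm _ (W _)]
  have hsupp : ∑ μ ∈ D.jointSupport ψ₁ ψ₂, D.dim μ * ‖D.reduction ψ₁ μ - D.reduction ψ₂ μ‖ =
      ∑ μ, D.dim μ * ‖D.reduction ψ₁ μ - D.reduction ψ₂ μ‖ :=
    Finset.sum_subset (Finset.subset_univ _) fun μ _ hμ => by
      rw [D.reduction_eq_of_notMem_jointSupport hμ, sub_self, norm_zero, mul_zero]
  refine ⟨V, hV, le_trans ?_ (Complex.re_le_norm _)⟩
  have hsum := Finset.sum_le_sum fun μ (_ : μ ∈ Finset.univ) => hle μ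
  rw [Finset.sum_sub_distrib, Finset.sum_add_distrib, D.sum_re_trace_reduction,
    D.sum_re_trace_reduction, ← Finset.mul_sum, ← hinner, ← hsupp] at hsum
  linarith

section FourierInversion

variable [MeasurableSpace G] [MeasurableMul G] {ν : Measure G} [ν.IsMulLeftInvariant]
  [IsProbabilityMeasure ν]

theorem dim_smul_integral_sum_trace_mul_smul_conjTranspose
    (hU : ∀ v, AEStronglyMeasurable (fun g => U g v) ν)
    (F : ∀ κ, Matrix (Fin (D.dim κ)) (Fin (D.dim κ)) ℂ) (μ : Fin D.numIrreps) :
    (D.dim μ : ℂ) • ∫ g, (∑ κ, ((D.irrep κ g).1 * F κ).trace) • (D.irrep μ g).1ᴴ ∂ν = F μ := by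
  have hm := D.aestronglyMeasurable_irrep_apply hU
  simp only [Finset.sum_smul]
  rw [integral_finsetSum _ fun κ _ => integrable_trace_mul_smul_conjTranspose (hm μ) (hm κ) (F κ),
    Finset.sum_eq_single_of_mem μ (Finset.mem_univ μ)]
  · exact dim_smul_integral_trace_mul_smul_conjTranspose (D.irreducible μ) (hm μ) (F μ)
  · intro κ _ hκ
    exact integral_trace_mul_smul_conjTranspose_eq_zero (D.irreducible μ) (D.irreducible κ)
      (D.inequivalent μ κ hκ.symm) (hm μ) (hm κ) (F κ)

theorem norm_le_dim_mul_integral_norm_sum_trace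
    (hU : ∀ v, AEStronglyMeasurable (fun g => U g v) ν)
    (F : ∀ κ, Matrix (Fin (D.dim κ)) (Fin (D.dim κ)) ℂ) (μ : Fin D.numIrreps) :
    ‖F μ‖ ≤ D.dim μ * ∫ g, ‖∑ κ, ((D.irrep κ g).1 * F κ).trace‖ ∂ν := by
  have : NeZero (D.dim μ) := ⟨(dim_pos_of_isIrreducible (D.irreducible μ)).ne'⟩
  have hnorm (g : G) : ‖(D.irrep μ g).1ᴴ‖ = 1 :=
    CStarRing.norm_of_mem_unitary (Unitary.star_mem (D.irrep μ g).2)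
  calc ‖F μ‖ = D.dim μ *
        ‖∫ g, (∑ κ, ((D.irrep κ g).1 * F κ).trace) • (D.irrep μ g).1ᴴ ∂ν‖ := by
        rw [← Complex.norm_natCast, ← norm_smul,
          D.dim_smul_integral_sum_trace_mul_smul_conjTranspose hU F μ]
    _ ≤ D.dim μ * ∫ g, ‖(∑ κ, ((D.irrep κ g).1 * F κ).trace) • (D.irrep μ g).1ᴴ‖ ∂ν := by
        gcongr
        exact norm_integral_le_integral_norm _
    _ = D.dim μ * ∫ g, ‖∑ κ, ((D.irrep κ g).1 * F κ).trace‖ ∂ν := by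
        simp only [norm_smul, hnorm, mul_one]

theorem norm_reduction_sub_le_integral_stateCharFun
    (hU : ∀ v, AEStronglyMeasurable (fun g => U g v) ν) (ψ₁ ψ₂ : H) (μ : Fin D.numIrreps) :
    ‖D.reduction ψ₁ μ - D.reduction ψ₂ μ‖ ≤
      D.dim μ * ∫ g, ‖stateCharFun U ψ₁ g - stateCharFun U ψ₂ g‖ ∂ν := by
  simp only [D.stateCharFun_eq_sum, ← Finset.sum_sub_distrib, charFunComponent_sub]
  exact D.norm_le_dim_mul_integral_norm_sum_trace hU
    (fun κ => D.reduction ψ₁ κ - D.reduction ψ₂ κ) μ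

theorem norm_reduction_sub_le_integral_charFunComponent
    (hU : ∀ v, AEStronglyMeasurable (fun g => U g v) ν) (ψ₁ ψ₂ : H) (μ : Fin D.numIrreps) :
    ‖D.reduction ψ₁ μ - D.reduction ψ₂ μ‖ ≤
      D.dim μ * ∫ g, ‖D.charFunComponent ψ₁ μ g - D.charFunComponent ψ₂ μ g‖ ∂ν := by
  let F := Pi.single (M := fun κ => Matrix (Fin (D.dim κ)) (Fin (D.dim κ)) ℂ) μ
    (D.reduction ψ₁ μ - D.reduction ψ₂ μ)
  have hF : F μ = D.reduction ψ₁ μ - D.reduction ψ₂ μ := Pi.single_eq_same _ _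
  have hsum (g : G) : ∑ κ, ((D.irrep κ g).1 * F κ).trace =
      D.charFunComponent ψ₁ μ g - D.charFunComponent ψ₂ μ g := by
    rw [Finset.sum_eq_single_of_mem μ (Finset.mem_univ μ), hF, charFunComponent_sub]
    intro κ _ hκ
    rw [show F κ = 0 from Pi.single_eq_of_ne hκ _, Matrix.mul_zero, trace_zero]
  simpa only [hF, hsum] using D.norm_le_dim_mul_integral_norm_sum_trace hU F μ

end FourierInversion

theorem exists_isGInvariant_overlap_bounds [MeasurableSpace G] [MeasurableMul G] (ν : Measure G)
    [ν.IsMulLeftInvariant] [IsProbabilityMeasure ν]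
    (hU : ∀ v, AEStronglyMeasurable (fun g => U g v) ν) (ψ₁ ψ₂ : H) :
    ∃ V : H ≃ₗᵢ[ℂ] H, IsGInvariant U V ∧
      (‖ψ₁‖ ^ 2 + ‖ψ₂‖ ^ 2) / 2 - 1 / 2 * (∑ μ ∈ D.jointSupport ψ₁ ψ₂, (D.dim μ : ℝ) ^ 2) *
          ∫ g, ‖stateCharFun U ψ₁ g - stateCharFun U ψ₂ g‖ ∂ν
        ≤ ‖inner ℂ ψ₂ (V ψ₁)‖ ∧
      (‖ψ₁‖ ^ 2 + ‖ψ₂‖ ^ 2) / 2 - 1 / 2 * ∑ μ ∈ D.jointSupport ψ₁ ψ₂, (D.dim μ : ℝ) ^ 2 *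
          ∫ g, ‖D.charFunComponent ψ₁ μ g - D.charFunComponent ψ₂ μ g‖ ∂ν
        ≤ ‖inner ℂ ψ₂ (V ψ₁)‖ := by
  obtain ⟨V, hV, hle⟩ := D.exists_isGInvariant_le_norm_inner ψ₁ ψ₂
  refine ⟨V, hV, le_trans ?_ hle, le_trans ?_ hle⟩
  · simp only [mul_assoc, Finset.sum_mul, sq]
    gcongr with μ
    exact D.norm_reduction_sub_le_integral_stateCharFun hU ψ₁ ψ₂ μ
  · simp only [mul_assoc, sq]
    gcongr with μ
    exact D.norm_reduction_sub_le_integral_charFunComponent hU ψ₁ ψ₂ μ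

end IrrepDecomposition

section Existence

variable {G : Type*} [Group G] {H : Type*} [NormedAddCommGroup H] [InnerProductSpace ℂ H]
  {U : G →* (H ≃ₗᵢ[ℂ] H)}

/-- `S` is a subrepresentation of `U`. -/
def IsInvariantSubspace (U : G →* (H ≃ₗᵢ[ℂ] H)) (S : Submodule ℂ H) : Prop :=
  ∀ g, ∀ v ∈ S, U g v ∈ S

/-- `S` is an irreducible subrepresentation of `U`, i.e. a minimal nonzero invariant subspace. -/
def IsIrreducibleSubspace (U : G →* (H ≃ₗᵢ[ℂ] H)) : Submodule ℂ H → Prop :=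
  Minimal fun S => IsInvariantSubspace U S ∧ S ≠ ⊥

/-- The family `v` spans a copy of the matrix representation `π` inside `U`: the linear map sending
the standard basis of `ℂ^d` to `v` intertwines `π` and `U`. -/
def TransformsBy (U : G →* (H ≃ₗᵢ[ℂ] H)) {d : ℕ} (π : G →* unitaryGroup (Fin d) ℂ)
    (v : Fin d → H) : Prop :=
  ∀ g i, U g (v i) = ∑ j, (π g).1 j i • v j

theorem inner_map_left_eq_inner_map_inv (g : G) (v w : H) :
    inner ℂ (U g v) w = inner ℂ v (U g⁻¹ w) := by
  rw [← (U g⁻¹).inner_map_map (U g v), ← Function.comp_apply (f := U g⁻¹),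
    ← LinearIsometryEquiv.coe_mul, ← map_mul, inv_mul_cancel, map_one, LinearIsometryEquiv.coe_one,
    id]

theorem IsInvariantSubspace.orthogonal {S : Submodule ℂ H} (hS : IsInvariantSubspace U S) :
    IsInvariantSubspace U Sᗮ := by
  intro g v hv
  rw [Submodule.mem_orthogonal'] at hv ⊢
  intro u hu
  rw [inner_map_left_eq_inner_map_inv]
  exact hv _ (hS _ _ hu)

theorem IsInvariantSubspace.inf {S T : Submodule ℂ H} (hS : IsInvariantSubspace U S)
    (hT : IsInvariantSubspace U T) : IsInvariantSubspace U (S ⊓ T) :=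
  fun g v hv => ⟨hS g v hv.1, hT g v hv.2⟩

open Classical in
theorem IsInvariantSubspace.exists_sup_eq [FiniteDimensional ℂ H] {S : Submodule ℂ H}
    (hS : IsInvariantSubspace U S) : ∃ s : Finset (Submodule ℂ H),
    (∀ M ∈ s, IsIrreducibleSubspace U M) ∧ (s : Set (Submodule ℂ H)).Pairwise (· ⟂ ·) ∧
      s.sup id = S := by
  induction S using WellFoundedLT.induction with
  | ind S ih =>
    by_cases hS0 : S = ⊥
    · exact ⟨∅, by simp, by simp, by simp [hS0]⟩
    obtain ⟨M, hMS, hM⟩ := exists_minimal_le_of_wellFoundedLT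
      (fun S => IsInvariantSubspace U S ∧ S ≠ ⊥) S ⟨hS, hS0⟩
    have hsup : M ⊔ Mᗮ ⊓ S = S := Submodule.sup_orthogonal_inf_of_hasOrthogonalProjection hMS
    have hlt : Mᗮ ⊓ S < S := by
      refine inf_le_right.lt_of_ne fun h => hM.prop.2 ?_
      exact (M.orthogonal_disjoint.eq_bot_of_le (hMS.trans (inf_eq_right.1 h)))
    obtain ⟨s, hs, hort, hssup⟩ := ih _ hlt (hM.prop.1.orthogonal.inf hS)
    refine ⟨insert M s, Finset.forall_mem_insert _ _ _ |>.2 ⟨hM, hs⟩, ?_, ?_⟩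
    · rw [Finset.coe_insert]
      refine Set.pairwise_insert_of_symm |>.2 ⟨hort, fun N hN _ => ?_⟩
      have hNM : N ⟂ M := (Finset.le_sup (f := id) hN).trans (hssup.le.trans inf_le_left)
      exact hNM.symm
    · rw [Finset.sup_insert, hssup, id, hsup]

theorem IsInvariantSubspace.exists_transformsBy {S : Submodule ℂ H}
    (hS : IsInvariantSubspace U S) {k : ℕ} (b : OrthonormalBasis (Fin k) ℂ S) :
    ∃ π : G →* unitaryGroup (Fin k) ℂ, TransformsBy U π fun i => (b i : H) := by
  let A (g : G) : Matrix (Fin k) (Fin k) ℂ := of fun j i => inner ℂ (b j : H) (U g (b i))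
  have hA (g : G) (i : Fin k) : U g (b i) = ∑ j, A g j i • (b j : H) := by
    simpa [A] using congrArg Subtype.val (b.sum_repr' ⟨U g (b i), hS g _ (b i).2⟩).symm
  have hA1 : A 1 = 1 := by
    ext i j
    simp only [A, of_apply, map_one, LinearIsometryEquiv.coe_one, id, one_apply,
      ← Submodule.coe_inner, b.inner_eq_ite]
  have hAmul (g h : G) : A (g * h) = A g * A h := by
    ext i j
    calc A (g * h) i j = inner ℂ (b i : H) (U g (∑ l, A h l j • (b l : H))) := by
          rw [← hA, ← Function.comp_apply (f := U g), ← LinearIsometryEquiv.coe_mul, ← map_mul]; rfl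
      _ = (A g * A h) i j := by
          simp only [map_sum, map_smul, inner_sum, inner_smul_right, mul_apply, A, of_apply,
            mul_comm]
  have hAstar (g : G) : star (A g) = A g⁻¹ := by
    ext i j
    simp only [A, star_apply, of_apply]
    rw [← inner_map_left_eq_inner_map_inv]
    exact inner_conj_symm _ _
  have hmem (g : G) : A g ∈ unitaryGroup (Fin k) ℂ := by
    rw [mem_unitaryGroup_iff, hAstar, ← hAmul, mul_inv_cancel, hA1]
  exact ⟨⟨⟨fun g => ⟨A g, hmem g⟩, Subtype.ext hA1⟩, fun g h => Subtype.ext (hAmul g h)⟩, hA⟩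

section TransformsBy

variable {d e : ℕ} {π : G →* unitaryGroup (Fin d) ℂ} {σ : G →* unitaryGroup (Fin e) ℂ}

theorem transformsBy_iff_map_linearCombination {v : Fin d → H} :
    TransformsBy U π v ↔ ∀ g x, U g (Fintype.linearCombination ℂ v x) =
      Fintype.linearCombination ℂ v (matrixRep π g x) := by
  refine ⟨fun hv g x => ?_, fun hv g i => ?_⟩
  · change _ = Fintype.linearCombination ℂ v ((π g).1 *ᵥ x)
    simp only [Fintype.linearCombination_apply, map_sum, map_smul, hv g, Finset.smul_sum,
      smul_smul, mulVec, dotProduct, Finset.sum_smul]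
    rw [Finset.sum_comm]
    simp only [mul_comm]
  · have h := hv g (Pi.single i 1)
    rw [Fintype.linearCombination_apply_single, one_smul] at h
    rw [h, Fintype.linearCombination_apply]
    exact Finset.sum_congr rfl fun j _ => congrArg (· • v j) (by simp [matrixRep])

theorem TransformsBy.smul {v : Fin d → H} (hv : TransformsBy U π v) (c : ℂ) :
    TransformsBy U π (c • v) := fun g i => by
  simp only [Pi.smul_apply, map_smul, hv g i, Finset.smul_sum, smul_comm c]

theorem TransformsBy.isIrreducible {M : Submodule ℂ H} (hM : IsIrreducibleSubspace U M)
    {b : Module.Basis (Fin d) ℂ M} (hb : TransformsBy U π fun i => (b i : H)) :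
    (matrixRep π).IsIrreducible := by
  let J : (Fin d → ℂ) →ₗ[ℂ] H := Fintype.linearCombination ℂ fun i => (b i : H)
  have hJ : J = M.subtype ∘ₗ b.equivFun.symm.toLinearMap := by
    ext x
    simp [J]
  have hinj : Function.Injective J := by
    rw [hJ]
    exact M.injective_subtype.comp b.equivFun.symm.injective
  have htop : Submodule.map J ⊤ = M := by simp [hJ]
  refine { exists_pair_ne := ⟨⊥, ⊤, fun h => hM.prop.2 ?_⟩, eq_bot_or_eq_top := fun N => ?_ }
  · have h' : (⊥ : Submodule ℂ (Fin d → ℂ)) = ⊤ := congrArg Subrepresentation.toSubmodule h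
    rw [← htop, ← h', Submodule.map_bot]
  have hN : IsInvariantSubspace U (N.toSubmodule.map J) := by
    rintro g _ ⟨x, hx, rfl⟩
    exact ⟨matrixRep π g x, N.apply_mem_toSubmodule g hx,
      (transformsBy_iff_map_linearCombination.1 hb g x).symm⟩
  by_cases hN0 : N.toSubmodule.map J = ⊥
  · refine .inl <| Subrepresentation.toSubmodule_injective ?_
    exact Submodule.map_injective_of_injective hinj (hN0.trans (Submodule.map_bot J).symm)
  · refine .inr <| Subrepresentation.toSubmodule_injective ?_
    exact Submodule.map_injective_of_injective hinj <|
      (hM.eq_of_le ⟨hN, hN0⟩ (htop ▸ Submodule.map_mono le_top)).trans htop.symm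

theorem TransformsBy.exists_of_equiv {S : Submodule ℂ H} {b : Module.Basis (Fin e) ℂ S}
    (hb : TransformsBy U σ fun i => (b i : H)) (f : (matrixRep π).Equiv (matrixRep σ)) :
    ∃ b' : Module.Basis (Fin d) ℂ S, TransformsBy U π fun i => (b' i : H) := by
  let b' := (Pi.basisFun ℂ (Fin d)).map (f.toLinearEquiv.trans b.equivFun.symm)
  have hb' (x : Fin d → ℂ) : Fintype.linearCombination ℂ (fun i => (b' i : H)) x =
      Fintype.linearCombination ℂ (fun i => (b i : H)) (f x) := by
    have h : b.equivFun.symm (f x) = ∑ i, x i • b' i := by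
      rw [← b'.equivFun_symm_apply]
      rfl
    simpa [Fintype.linearCombination_apply, b.equivFun_symm_apply] using
      congrArg Subtype.val h.symm
  refine ⟨b', transformsBy_iff_map_linearCombination.2 fun g x => ?_⟩
  rw [hb', hb', transformsBy_iff_map_linearCombination.1 hb]
  exact congrArg _
    (Representation.IntertwiningMap.isIntertwining _ _ f.toIntertwiningMap g x).symm

theorem TransformsBy.exists_gram_eq (hπ : (matrixRep π).IsIrreducible) {v : Fin d → H}
    (hv : TransformsBy U π v) : ∃ c : ℂ, gram ℂ v = c • 1 := by
  refine exists_eq_smul_one_of_commutes hπ fun g => ?_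
  have hg : (π g).1ᴴ * gram ℂ v * (π g).1 = gram ℂ v := by
    ext i j
    rw [gram_apply, ← (U g).inner_map_map, hv g, hv g]
    simp only [sum_inner, inner_sum, inner_smul_left, inner_smul_right, mul_apply,
      conjTranspose_apply, gram_apply, Finset.sum_mul]
    refine Finset.sum_congr rfl fun k _ => ?_
    rw [Finset.mul_sum]
    exact Finset.sum_congr rfl fun l _ => by rw [starRingEnd_apply]; ring
  have hu : (π g).1 * (π g).1ᴴ = 1 := mem_unitaryGroup_iff.1 (π g).2
  calc gram ℂ v * (π g).1 = (π g).1 * (π g).1ᴴ * (gram ℂ v * (π g).1) := by rw [hu, one_mul]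
    _ = (π g).1 * ((π g).1ᴴ * gram ℂ v * (π g).1) := by simp only [mul_assoc]
    _ = (π g).1 * gram ℂ v := by rw [hg]

theorem TransformsBy.exists_orthonormal_smul (hπ : (matrixRep π).IsIrreducible) {v : Fin d → H}
    (hv : TransformsBy U π v) (hv0 : v ≠ 0) : ∃ r : ℝ, r ≠ 0 ∧ Orthonormal ℂ ((r : ℂ) • v) := by
  obtain ⟨c, hc⟩ := hv.exists_gram_eq hπ
  obtain ⟨i, hi⟩ := Function.ne_iff.1 hv0
  have hc' : c = (‖v i‖ : ℂ) ^ 2 := by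
    simpa [inner_self_eq_norm_sq_to_K] using (congrFun₂ hc i i).symm
  have hi0 : (‖v i‖ : ℂ) ≠ 0 := by simpa using hi
  refine ⟨‖v i‖⁻¹, by simpa using hi, gram_eq_one_iff_orthonormal.1 ?_⟩
  ext k l
  have hkl := congrFun₂ hc k l
  rw [gram_apply] at hkl
  simp only [gram_apply, Pi.smul_apply, inner_smul_left, inner_smul_right, hkl, hc',
    Matrix.smul_apply, smul_eq_mul, Complex.conj_ofReal]
  push_cast
  field_simp

theorem TransformsBy.exists_orthonormalBasis (hπ : (matrixRep π).IsIrreducible)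
    {S : Submodule ℂ H} {b : Module.Basis (Fin d) ℂ S} (hb : TransformsBy U π fun i => (b i : H)) :
    ∃ b' : OrthonormalBasis (Fin d) ℂ S, TransformsBy U π fun i => (b' i : H) := by
  have hb0 : (fun i => (b i : H)) ≠ 0 := fun h =>
    b.ne_zero ⟨0, dim_pos_of_isIrreducible hπ⟩ (Subtype.ext (congrFun h _))
  obtain ⟨r, hr, hort⟩ := hb.exists_orthonormal_smul hπ hb0
  have hr' : IsUnit (r : ℂ) := by simpa using hr
  let b' := (b.isUnitSMul fun _ => hr').toOrthonormalBasis (by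
    simpa [orthonormal_iff_ite, Module.Basis.isUnitSMul_apply] using hort)
  have hb' : (fun i => (b' i : H)) = (r : ℂ) • fun i => (b i : H) := by
    ext i
    simp [b', Module.Basis.isUnitSMul_apply]
  exact ⟨b', hb' ▸ hb.smul r⟩

end TransformsBy

/-- Sorting by classes a disjoint union over `x` whose summands `F (c x)` depend only on the class
`c x`: for irreps, `⨁_x M_{c x} = ⨁_μ M_μ ⊗ N_μ` with `N_μ` spanned by the fibre of `c` over `μ`. -/
def sigmaFiberProdEquiv {ι κ : Type*} (c : ι → κ) (F : κ → Type*) :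
    (Σ x, F (c x)) ≃ Σ μ, F μ × {x // c x = μ} where
  toFun p := ⟨c p.1, p.2, p.1, rfl⟩
  invFun p := ⟨p.2.2.1, cast (congrArg F p.2.2.2.symm) p.2.1⟩
  left_inv _ := rfl
  right_inv := fun ⟨_, _, _, h⟩ => by subst h; rfl

theorem nonempty_irrepDecomposition_of_orthonormalBasis {ι : Type*} [Fintype ι] {n : ℕ}
    {c : ι → Fin n} (hc : Function.Surjective c) {d : Fin n → ℕ}
    {π : ∀ μ, G →* unitaryGroup (Fin (d μ)) ℂ} (hπ : ∀ μ, (matrixRep (π μ)).IsIrreducible)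
    (hne : ∀ μ ν, μ ≠ ν → IsEmpty ((matrixRep (π μ)).Equiv (matrixRep (π ν))))
    (b : OrthonormalBasis (Σ x, Fin (d (c x))) ℂ H)
    (hb : ∀ x, TransformsBy U (π (c x)) fun i => b ⟨x, i⟩) : Nonempty (IrrepDecomposition U) := by
  classical
  let ε (μ : Fin n) : {x // c x = μ} ≃ Fin (Fintype.card {x // c x = μ}) := Fintype.equivFin _
  let e : (Σ x, Fin (d (c x))) ≃ Σ μ, Fin (d μ) × Fin (Fintype.card {x // c x = μ}) :=
    sigmaFiberProdEquiv c (fun μ => Fin (d μ)) |>.trans <|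
      .sigmaCongrRight fun μ => .prodCongr (.refl _) (ε μ)
  have he (x : ι) (i : Fin (d (c x))) : b.reindex e ⟨c x, i, ε _ ⟨x, rfl⟩⟩ = b ⟨x, i⟩ := by
    rw [b.reindex_apply]
    exact congrArg b (e.symm_apply_eq.2 rfl)
  exact ⟨{
    numIrreps := n
    dim := d
    mult := fun μ => Fintype.card {x // c x = μ}
    mult_pos := fun μ => Fintype.card_pos_iff.2 ((hc μ).elim fun x hx => ⟨⟨x, hx⟩⟩)
    irrep := π
    irreducible := hπ
    inequivalent := hne
    basis := b.reindex e
    map_basis := fun g μ i a => by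
      obtain ⟨⟨x, rfl⟩, rfl⟩ := (ε μ).surjective a
      simp only [he]
      exact hb x g i }⟩

theorem exists_orthogonalFamily_irreducible [FiniteDimensional ℂ H] (U : G →* (H ≃ₗᵢ[ℂ] H)) :
    ∃ s : Finset (Submodule ℂ H), (∀ M ∈ s, IsIrreducibleSubspace U M) ∧
      OrthogonalFamily ℂ (fun M : s => M.1) (fun M => M.1.subtypeₗᵢ) ∧ ⨆ M : s, M.1 = ⊤ := by
  obtain ⟨s, hs, hort, hsup⟩ := IsInvariantSubspace.exists_sup_eq (U := U) (S := ⊤)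
    fun _ _ _ => Submodule.mem_top
  refine ⟨s, hs, .of_pairwise fun M N hMN => hort M.2 N.2 fun h => hMN (Subtype.ext h), ?_⟩
  rw [← hsup, Finset.sup_eq_iSup, iSup_subtype]
  rfl

theorem nonempty_irrepDecomposition [FiniteDimensional ℂ H] (U : G →* (H ≃ₗᵢ[ℂ] H)) :
    Nonempty (IrrepDecomposition U) := by
  classical
  obtain ⟨s, hs, hV, htop⟩ := exists_orthogonalFamily_irreducible U
  have hint : DirectSum.IsInternal fun M : s => M.1 := by
    rw [hV.isInternal_iff, htop, Submodule.top_orthogonal_eq_bot]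
  choose σ hσ using fun M : s =>
    (hs M.1 M.2).prop.1.exists_transformsBy (stdOrthonormalBasis ℂ M.1)
  simp only [← OrthonormalBasis.coe_toBasis] at hσ
  have hσi (M : s) : (matrixRep (σ M)).IsIrreducible := (hσ M).isIrreducible (hs M.1 M.2)
  let r : Setoid s :=
    { r := fun M N => Nonempty ((matrixRep (σ M)).Equiv (matrixRep (σ N)))
      iseqv := ⟨fun _ => ⟨.refl _⟩, fun ⟨f⟩ => ⟨f.symm⟩, fun ⟨f⟩ ⟨f'⟩ => ⟨f.trans f'⟩⟩ }
  let q : Quotient r ≃ Fin (Fintype.card (Quotient r)) := Fintype.equivFin _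
  let c (M : s) := q ⟦M⟧
  let rep (μ : Fin (Fintype.card (Quotient r))) : s := (q.symm μ).out
  have hc_rep (μ) : c (rep μ) = μ := by simp [c, rep]
  have hequiv (M : s) : Nonempty ((matrixRep (σ (rep (c M)))).Equiv (matrixRep (σ M))) :=
    Quotient.exact (q.injective (hc_rep (c M)))
  choose b hb using fun M => (hσ M).exists_of_equiv (hequiv M).some
  choose b' hb' using fun M => (hb M).exists_orthonormalBasis (hσi (rep (c M)))
  refine nonempty_irrepDecomposition_of_orthonormalBasis (c := c) (fun μ => ⟨rep μ, hc_rep μ⟩)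
    (fun μ => hσi (rep μ)) (fun μ ν hμν => ⟨fun f => hμν ?_⟩)
    (hint.collectedOrthonormalBasis hV b') fun M => ?_
  · rw [← hc_rep μ, ← hc_rep ν]
    exact congrArg q (Quotient.sound ⟨f⟩)
  · simpa [DirectSum.IsInternal.collectedOrthonormalBasis] using hb' M

end Existence

theorem mainTheorem9_general {G : Type*} [Group G] [MeasurableSpace G] [MeasurableMul G]
    (ν : Measure G) [ν.IsMulLeftInvariant] [IsProbabilityMeasure ν]
    {H : Type*} [NormedAddCommGroup H] [InnerProductSpace ℂ H] [FiniteDimensional ℂ H]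
    (U : G →* (H ≃ₗᵢ[ℂ] H)) (hU : ∀ v : H, AEStronglyMeasurable (fun g => U g v) ν)
    (ψ₁ ψ₂ : H) :
    Nonempty (IrrepDecomposition U) ∧
    ∀ D : IrrepDecomposition U, ∃ V : H ≃ₗᵢ[ℂ] H, IsGInvariant U V ∧
      (‖ψ₁‖ ^ 2 + ‖ψ₂‖ ^ 2) / 2 - 1 / 2 * (∑ μ ∈ D.jointSupport ψ₁ ψ₂, (D.dim μ : ℝ) ^ 2) *
          ∫ g, ‖stateCharFun U ψ₁ g - stateCharFun U ψ₂ g‖ ∂ν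
        ≤ ‖inner ℂ ψ₂ (V ψ₁)‖ ∧
      (‖ψ₁‖ ^ 2 + ‖ψ₂‖ ^ 2) / 2 - 1 / 2 * ∑ μ ∈ D.jointSupport ψ₁ ψ₂, (D.dim μ : ℝ) ^ 2 *
          ∫ g, ‖D.charFunComponent ψ₁ μ g - D.charFunComponent ψ₂ μ g‖ ∂ν
        ≤ ‖inner ℂ ψ₂ (V ψ₁)‖ :=
  ⟨nonempty_irrepDecomposition U, fun D => D.exists_isGInvariant_overlap_bounds ν hU ψ₁ ψ₂⟩

end

theorem mainTheorem9 {G : Type*} [Group G] [TopologicalSpace G] [IsTopologicalGroup G]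
    [CompactSpace G] [T2Space G] [MeasurableSpace G] [BorelSpace G]
    (haar : MeasureTheory.Measure G) [haar.IsHaarMeasure] [MeasureTheory.IsProbabilityMeasure haar]
    {H : Type*} [NormedAddCommGroup H] [InnerProductSpace ℂ H] [FiniteDimensional ℂ H]
    (U : G →* (H ≃ₗᵢ[ℂ] H)) (hU : ∀ v : H, Continuous fun g => U g v)
    (ψ₁ ψ₂ : H) (hψ₁ : ‖ψ₁‖ = 1) (hψ₂ : ‖ψ₂‖ = 1) :
    Nonempty (IrrepDecomposition U) ∧
    ∀ D : IrrepDecomposition U, ∃ V : H ≃ₗᵢ[ℂ] H, IsGInvariant U V ∧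
      1 - 1 / 2 * (∑ μ ∈ D.jointSupport ψ₁ ψ₂, (D.dim μ : ℝ) ^ 2) *
          ∫ g, ‖stateCharFun U ψ₁ g - stateCharFun U ψ₂ g‖ ∂haar
        ≤ ‖inner ℂ ψ₂ (V ψ₁)‖ ∧
      1 - 1 / 2 * ∑ μ ∈ D.jointSupport ψ₁ ψ₂, (D.dim μ : ℝ) ^ 2 *
          ∫ g, ‖D.charFunComponent ψ₁ μ g - D.charFunComponent ψ₂ μ g‖ ∂haar
        ≤ ‖inner ℂ ψ₂ (V ψ₁)‖ := by
  have := FiniteDimensional.proper ℂ H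
  simpa [hψ₁, hψ₂] using
    mainTheorem9_general haar U (fun v => (hU v).aestronglyMeasurable) ψ₁ ψ₂
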